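/- Let $G$ be a finite simple graph of order $n\ge 1$ with adjacency eigenvalues $\lambda_1(G)\ge\lambda_2(G)\ge\dots\ge\lambda_n(G)$, counted with multiplicity, and let $$R(G)=\max\{|\lambda_h(G)|,\,|\lambda_l(G)|\},\qquad h=\left\lfloor\tfrac{n+1}{2}\right\rfloor,\quad l=\left\lceil\tfrac{n+1}{2}\right\rceil.$$ If $G$ is subcubic (its maximum degree is at most $3$) and $G$ is $K_4$-minor-free (that is, $K_4$ cannot be obtained from $G$ by deleting vertices, deleting edges and contracting edges), then $R(G)\le 1$. -/

import Mathlib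

/-- `H` is a minor of `G`: there are pairwise disjoint branch sets `B w` of vertices of `G`, one for
each vertex `w` of `H`, each inducing a (nonempty) connected subgraph of `G`, with an edge of `G`
between `B w` and `B w'` whenever `w` and `w'` are adjacent in `H`. Contracting each branch set to a
vertex and deleting the superfluous edges and vertices of `G` leaves a copy of `H`. -/
def SimpleGraph.HasMinor {V W : Type*} (G : SimpleGraph V) (H : SimpleGraph W) : Prop :=
  ∃ B : W → Set V,
    (∀ w, (G.induce (B w)).Connected) ∧
    (∀ w w', w ≠ w' → Disjoint (B w) (B w')) ∧
    (∀ w w', H.Adj w w' → ∃ x ∈ B w, ∃ y ∈ B w', G.Adj x y)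

/-- `G` is `H`-minor-free. -/
def SimpleGraph.MinorFree {V W : Type*} (G : SimpleGraph V) (H : SimpleGraph W) : Prop :=
  ¬ G.HasMinor H

/-- A (finite) graph is subcubic if its maximum degree is at most `3`. -/
def SimpleGraph.IsSubcubic {V : Type*} [Fintype V] (G : SimpleGraph V) [DecidableRel G.Adj] :
    Prop :=
  G.maxDegree ≤ 3

theorem SimpleGraph.adjMatrix_real_isHermitian {V : Type*} (G : SimpleGraph V)
    [DecidableRel G.Adj] : (G.adjMatrix ℝ).IsHermitian := by
  rw [Matrix.IsHermitian, Matrix.conjTranspose_eq_transpose_of_trivial]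
  exact G.transpose_adjMatrix

/-- The `i`-th largest adjacency eigenvalue of `G`, counting multiplicities, for `1 ≤ i ≤ |V|`
(`Matrix.IsHermitian.eigenvalues₀` lists the eigenvalues in decreasing order from index `0`). -/
noncomputable def SimpleGraph.adjEigenvalue {V : Type*} [Fintype V] [DecidableEq V]
    (G : SimpleGraph V) [DecidableRel G.Adj] (i : ℕ) (hi : 1 ≤ i ∧ i ≤ Fintype.card V) : ℝ :=
  G.adjMatrix_real_isHermitian.eigenvalues₀ ⟨i - 1, by omega⟩

theorem floor_median_mem {n : ℕ} (hn : 0 < n) : 1 ≤ (n + 1) / 2 ∧ (n + 1) / 2 ≤ n := by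
  omega

theorem ceil_median_mem {n : ℕ} (hn : 0 < n) : 1 ≤ (n + 1) ⌈/⌉ 2 ∧ (n + 1) ⌈/⌉ 2 ≤ n := by
  rw [Nat.ceilDiv_eq_add_pred_div]
  omega

/-- The HL-index `R(G) = max {|λ_h|, |λ_l|}` of a graph of order `n ≥ 1`, where
`h = ⌊(n + 1) / 2⌋` and `l = ⌈(n + 1) / 2⌉`. -/
noncomputable def SimpleGraph.hlIndex {V : Type*} [Fintype V] [DecidableEq V] [Nonempty V]
    (G : SimpleGraph V) [DecidableRel G.Adj] : ℝ :=
  max |G.adjEigenvalue ((Fintype.card V + 1) / 2) (floor_median_mem Fintype.card_pos)|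
    |G.adjEigenvalue ((Fintype.card V + 1) ⌈/⌉ 2) (ceil_median_mem Fintype.card_pos)|

open Matrix in
/-- Coordinates in an eigenvector basis diagonalize a real symmetric quadratic form. -/
theorem Matrix.IsHermitian.exists_eigenvalue_coordinates {V : Type*} [Fintype V] [DecidableEq V]
    {A : Matrix V V ℝ} (hA : A.IsHermitian) :
    ∃ c : (V → ℝ) →ₗ[ℝ] (V → ℝ), (∀ x, x ⬝ᵥ x = ∑ i, c x i ^ 2) ∧
      ∀ x, x ⬝ᵥ (A *ᵥ x) = ∑ i, hA.eigenvalues i * c x i ^ 2 := by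
  set U : Matrix V V ℝ := (hA.eigenvectorUnitary : Matrix V V ℝ) with hU
  have hUU : U * star U = 1 := Unitary.coe_mul_star_self hA.eigenvectorUnitary
  have hst : star U = Uᵀ := by
    rw [star_eq_conjTranspose, conjTranspose_eq_transpose_of_trivial]
  have key : ∀ (D : Matrix V V ℝ) (x : V → ℝ),
      x ⬝ᵥ ((U * D * star U) *ᵥ x) = (star U *ᵥ x) ⬝ᵥ (D *ᵥ (star U *ᵥ x)) := by
    intro D x
    rw [← mulVec_mulVec, ← mulVec_mulVec, dotProduct_mulVec, hst, mulVec_transpose]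
  refine ⟨(star U).mulVecLin, fun x => ?_, fun x => ?_⟩
  · have h := key 1 x
    rw [mul_one, hUU, one_mulVec, one_mulVec] at h
    rw [h]
    simp [dotProduct, sq]
  · have hspec : A = U * diagonal hA.eigenvalues * star U := by
      conv_lhs => rw [hA.spectral_theorem]
      simp [Unitary.conjStarAlgAut_apply, hU]
    conv_lhs => rw [hspec]
    rw [key]
    refine Finset.sum_congr rfl fun i _ => ?_
    rw [mulVec_diagonal, mulVecLin_apply]
    ring

open Matrix in
/-- A subspace on which `σ * A ≤ 1` meets the span of the eigenvectors with `1 < σ * λ` trivially. -/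
theorem Matrix.IsHermitian.card_add_finrank_le {V : Type*} [Fintype V] [DecidableEq V]
    {A : Matrix V V ℝ} (hA : A.IsHermitian) (σ : ℝ) (N : Submodule ℝ (V → ℝ))
    (hN : ∀ x ∈ N, σ * (x ⬝ᵥ (A *ᵥ x)) ≤ x ⬝ᵥ x) :
    (Finset.univ.filter fun i => 1 < σ * hA.eigenvalues i).card + Module.finrank ℝ N
      ≤ Fintype.card V := by
  obtain ⟨c, hc, hcA⟩ := hA.exists_eigenvalue_coordinates
  let f : N →ₗ[ℝ] ({i // ¬ 1 < σ * hA.eigenvalues i} → ℝ) :=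
    (LinearMap.funLeft ℝ ℝ Subtype.val).comp (c.comp N.subtype)
  have hf : Function.Injective f := by
    rw [← LinearMap.ker_eq_bot, LinearMap.ker_eq_bot']
    rintro ⟨x, hx⟩ h0
    have hzero : ∀ i, ¬ 1 < σ * hA.eigenvalues i → c x i = 0 := fun i hi =>
      congrFun h0 ⟨i, hi⟩
    have hle := hN x hx
    rw [hcA, hc, Finset.mul_sum] at hle
    have hterm : ∀ i ∈ Finset.univ, 0 ≤ (σ * (hA.eigenvalues i * c x i ^ 2) - c x i ^ 2) := by
      intro i _
      by_cases hi : 1 < σ * hA.eigenvalues i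
      · nlinarith [sq_nonneg (c x i)]
      · simp [hzero i hi]
    have hsum := (Finset.sum_eq_zero_iff_of_nonneg hterm).1
      (le_antisymm (by rw [Finset.sum_sub_distrib]; linarith) (Finset.sum_nonneg hterm))
    have hall : ∀ i, c x i ^ 2 = 0 := by
      intro i
      by_cases hi : 1 < σ * hA.eigenvalues i
      · have h1 := hsum i (Finset.mem_univ i)
        have h2 : (σ * hA.eigenvalues i - 1) * c x i ^ 2 = 0 := by linarith
        rcases mul_eq_zero.1 h2 with h3 | h3
        · linarith
        · exact h3
      · simp [hzero i hi]
    have hxx : x ⬝ᵥ x = 0 := by rw [hc]; simp [hall]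
    exact Subtype.ext (dotProduct_self_eq_zero.1 hxx)
  have h1 := LinearMap.finrank_le_finrank_of_injective hf
  rw [Module.finrank_fintype_fun_eq_card, Fintype.card_subtype_compl, Fintype.card_subtype] at h1
  have h2 := Finset.card_le_univ (Finset.univ.filter fun i => 1 < σ * hA.eigenvalues i)
  omega

theorem Matrix.IsHermitian.card_filter_eigenvalues {V : Type*} [Fintype V] [DecidableEq V]
    {A : Matrix V V ℝ} (hA : A.IsHermitian) (p : ℝ → Prop) [DecidablePred p] :
    (Finset.univ.filter fun i => p (hA.eigenvalues i)).card =
      (Finset.univ.filter fun i => p (hA.eigenvalues₀ i)).card := by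
  unfold Matrix.IsHermitian.eigenvalues
  refine Finset.card_bij (fun i _ => (Fintype.equivOfCardEq (Fintype.card_fin _)).symm i)
    (by simp) (by simp) (fun b hb => ⟨Fintype.equivOfCardEq (Fintype.card_fin _) b, ?_, ?_⟩)
  · simpa using hb
  · simp

theorem SimpleGraph.hlIndex_le_one_of_subspaces {V : Type*} [Fintype V] [DecidableEq V] [Nonempty V]
    (G : SimpleGraph V) [DecidableRel G.Adj]
    (h : ∀ σ : ℝ, |σ| = 1 → ∃ N : Submodule ℝ (V → ℝ), Fintype.card V < 2 * Module.finrank ℝ N ∧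
      ∀ x ∈ N, σ * (x ⬝ᵥ ((G.adjMatrix ℝ).mulVec x)) ≤ x ⬝ᵥ x) :
    G.hlIndex ≤ 1 := by
  have hA := G.adjMatrix_real_isHermitian
  have hcard : ∀ σ : ℝ, |σ| = 1 →
      2 * (Finset.univ.filter fun i => 1 < σ * hA.eigenvalues₀ i).card < Fintype.card V := by
    intro σ hσ
    obtain ⟨N, hN, hq⟩ := h σ hσ
    have h1 := hA.card_add_finrank_le σ N hq
    rw [hA.card_filter_eigenvalues (fun t => 1 < σ * t)] at h1
    omega
  have hpos : 0 < Fintype.card V := Fintype.card_pos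
  have hceil : (Fintype.card V + 1) ⌈/⌉ 2 = (Fintype.card V + 2) / 2 :=
    Nat.ceilDiv_eq_add_pred_div ..
  have hupper : ∀ i : Fin (Fintype.card V), Fintype.card V ≤ 2 * i.1 + 2 →
      hA.eigenvalues₀ i ≤ 1 := by
    intro i hi
    by_contra! hlt
    have h1 := hcard 1 (by simp)
    have h2 : Finset.Iic i ⊆ Finset.univ.filter fun j => 1 < 1 * hA.eigenvalues₀ j := by
      intro j hj
      have := hA.eigenvalues₀_antitone (Finset.mem_Iic.1 hj)
      simp only [Finset.mem_filter, Finset.mem_univ, true_and, one_mul]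
      linarith
    have h3 := Finset.card_le_card h2
    rw [Fin.card_Iic] at h3
    omega
  have hlower : ∀ i : Fin (Fintype.card V), 2 * i.1 ≤ Fintype.card V →
      -1 ≤ hA.eigenvalues₀ i := by
    intro i hi
    by_contra! hlt
    have h1 := hcard (-1) (by simp)
    have h2 : Finset.Ici i ⊆ Finset.univ.filter fun j => 1 < -1 * hA.eigenvalues₀ j := by
      intro j hj
      have := hA.eigenvalues₀_antitone (Finset.mem_Ici.1 hj)
      simp only [Finset.mem_filter, Finset.mem_univ, true_and]
      linarith
    have h3 := Finset.card_le_card h2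
    rw [Fin.card_Ici] at h3
    omega
  unfold SimpleGraph.hlIndex SimpleGraph.adjEigenvalue
  refine max_le (abs_le.2 ⟨hlower _ ?_, hupper _ ?_⟩) (abs_le.2 ⟨hlower _ ?_, hupper _ ?_⟩) <;>
    simp only [hceil] <;> omega
open Classical in
/-- The form `x ↦ σ ⟨x, A x⟩ - ⟨x, x⟩` is nonpositive on a subspace of dimension more than half
the order of the graph. -/
def SimpleGraph.HasLargeSubspace {V : Type*} [Fintype V] (G : SimpleGraph V) (σ : ℝ) : Prop :=
  ∃ N : Submodule ℝ (V → ℝ), Fintype.card V < 2 * Module.finrank ℝ N ∧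
    ∀ x ∈ N, σ * (x ⬝ᵥ ((G.adjMatrix ℝ).mulVec x)) ≤ x ⬝ᵥ x

theorem extendByZero_dotProduct {W V : Type*} [Fintype W] [Fintype V] {e : W → V}
    (he : Function.Injective e) (y : W → ℝ) (z : V → ℝ) :
    Function.ExtendByZero.linearMap ℝ e y ⬝ᵥ z = y ⬝ᵥ (z ∘ e) := by
  refine (Fintype.sum_of_injective e he _ _ (fun i hi => ?_) fun i => ?_).symm
  · rw [Function.ExtendByZero.linearMap_apply, Function.extend_apply' _ _ _ hi, Pi.zero_apply,
      zero_mul]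
  · rw [Function.ExtendByZero.linearMap_apply, he.extend_apply, Function.comp_apply]

theorem extendByZero_injective {W V : Type*} {e : W → V} (he : Function.Injective e) :
    Function.Injective (Function.ExtendByZero.linearMap ℝ e) := by
  intro x y hxy
  funext i
  have := congrFun hxy (e i)
  simpa [Function.ExtendByZero.linearMap_apply, he.extend_apply] using this

theorem finrank_range_extendByZero {V : Type*} (U : Finset V) :
    Module.finrank ℝ (LinearMap.range
      (Function.ExtendByZero.linearMap ℝ (Subtype.val : U → V))) = U.card := by
  rw [LinearMap.finrank_range_of_inj (extendByZero_injective Subtype.val_injective),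
    Module.finrank_fintype_fun_eq_card, Fintype.card_coe]

theorem eq_zero_of_mem_range_extendByZero {V : Type*} {U : Finset V} {x : V → ℝ}
    (hx : x ∈ LinearMap.range (Function.ExtendByZero.linearMap ℝ (Subtype.val : U → V)))
    {v : V} (hv : v ∉ U) : x v = 0 := by
  obtain ⟨y, rfl⟩ := hx
  refine Function.extend_apply' _ _ _ ?_
  rintro ⟨w, rfl⟩
  exact hv w.2

namespace SimpleGraph

variable {V : Type*} [Fintype V] {G : SimpleGraph V} {σ : ℝ}

open Classical in
theorem dotProduct_adjMatrix_extendByZero {W : Type*} [Fintype W] (e : W ↪ V) (y : W → ℝ) :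
    Function.ExtendByZero.linearMap ℝ e y ⬝ᵥ
        ((G.adjMatrix ℝ).mulVec (Function.ExtendByZero.linearMap ℝ e y)) =
      y ⬝ᵥ (((G.comap e).adjMatrix ℝ).mulVec y) := by
  rw [extendByZero_dotProduct e.injective]
  congr 1
  funext w
  rw [Function.comp_apply, Matrix.mulVec, dotProduct_comm, extendByZero_dotProduct e.injective,
    dotProduct_comm]
  rfl

open Classical in
theorem hasLargeSubspace_of_induce (S : Finset V) (X : Submodule ℝ (V → ℝ))
    (hsupp : ∀ x ∈ X, ∀ v ∉ S, x v = 0)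
    (hout : ∀ x ∈ X, ∀ v ∉ S, (G.adjMatrix ℝ).mulVec x v = 0)
    (hform : ∀ x ∈ X, σ * (x ⬝ᵥ ((G.adjMatrix ℝ).mulVec x)) ≤ x ⬝ᵥ x)
    (hdim : S.card ≤ 2 * Module.finrank ℝ X)
    (hstrict : (∃ v, v ∉ S) ∨ S.card < 2 * Module.finrank ℝ X)
    (ih : (∃ v, v ∉ S) → (G.induce {v | v ∉ S}).HasLargeSubspace σ) :
    G.HasLargeSubspace σ := by
  have hcard : Fintype.card V = S.card + Fintype.card {v // v ∉ S} := by
    rw [Fintype.card_subtype_compl, Fintype.card_coe]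
    have := S.card_le_univ
    omega
  by_cases hS : ∃ v, v ∉ S
  swap
  · refine ⟨X, ?_, hform⟩
    have h0 : Fintype.card {v // v ∉ S} = 0 :=
      Fintype.card_eq_zero_iff.2 ⟨fun v => hS ⟨v.1, v.2⟩⟩
    have := hstrict.resolve_left hS
    omega
  let e : {v // v ∉ S} ↪ V := Function.Embedding.subtype _
  obtain ⟨N, hN, hNform⟩ : ∃ N : Submodule ℝ ({v // v ∉ S} → ℝ),
      Fintype.card {v // v ∉ S} < 2 * Module.finrank ℝ N ∧
      ∀ y ∈ N, σ * (y ⬝ᵥ (((G.comap e).adjMatrix ℝ).mulVec y)) ≤ y ⬝ᵥ y := by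
    obtain ⟨N, hN, hNform⟩ := ih hS
    exact ⟨N, by convert hN, fun y hy => by convert hNform y hy⟩
  let E := Function.ExtendByZero.linearMap ℝ e
  have hE : Function.Injective E := extendByZero_injective e.injective
  have hEsupp : ∀ y, ∀ v ∈ S, E y v = 0 := by
    intro y v hv
    refine Function.extend_apply' _ _ _ ?_
    rintro ⟨w, rfl⟩
    exact w.2 hv
  have hdisj : Disjoint X (N.map E) := by
    rw [Submodule.disjoint_def]
    rintro x hx ⟨y, -, rfl⟩
    funext v
    by_cases hv : v ∈ S
    · exact hEsupp y v hv
    · exact hsupp _ hx v hv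
  have hfin : Module.finrank ℝ (X ⊔ N.map E : Submodule ℝ (V → ℝ)) =
      Module.finrank ℝ X + Module.finrank ℝ N := by
    have h1 := Submodule.finrank_sup_add_finrank_inf_eq X (N.map E)
    rw [hdisj.eq_bot, finrank_bot, ← (Submodule.equivMapOfInjective E hE N).finrank_eq] at h1
    omega
  refine ⟨X ⊔ N.map E, ?_, ?_⟩
  · rw [hfin]
    omega
  · intro z hz
    obtain ⟨x, hx, _, ⟨y, hy, rfl⟩, rfl⟩ := Submodule.mem_sup.1 hz
    have hxy : E y ⬝ᵥ x = 0 := by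
      refine Finset.sum_eq_zero fun v _ => ?_
      by_cases hv : v ∈ S
      · rw [hEsupp y v hv, zero_mul]
      · rw [hsupp x hx v hv, mul_zero]
    have hyAx : E y ⬝ᵥ ((G.adjMatrix ℝ).mulVec x) = 0 := by
      refine Finset.sum_eq_zero fun v _ => ?_
      by_cases hv : v ∈ S
      · rw [hEsupp y v hv, zero_mul]
      · rw [hout x hx v hv, mul_zero]
    have hxAy : x ⬝ᵥ ((G.adjMatrix ℝ).mulVec (E y)) = 0 := by
      rw [Matrix.dotProduct_mulVec, ← Matrix.mulVec_transpose, G.transpose_adjMatrix,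
        dotProduct_comm, hyAx]
    have hq := hform x hx
    have hq' : σ * (E y ⬝ᵥ ((G.adjMatrix ℝ).mulVec (E y))) ≤ E y ⬝ᵥ E y := by
      rw [show E y ⬝ᵥ ((G.adjMatrix ℝ).mulVec (E y)) = _ from
        dotProduct_adjMatrix_extendByZero e y]
      have h2 : E y ⬝ᵥ E y = y ⬝ᵥ y := by
        rw [show E y ⬝ᵥ E y = y ⬝ᵥ (E y ∘ e) from extendByZero_dotProduct e.injective y (E y)]
        congr 1
        funext w
        exact e.injective.extend_apply _ _ _
      rw [h2]
      exact hNform y hy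
    simp only [Matrix.mulVec_add, dotProduct_add, add_dotProduct]
    rw [dotProduct_comm x (E y), hxy, hyAx, hxAy]
    linarith

open Classical in
/-- Removing a set `U` that induces a form bounded by `1` together with its neighbours. -/
theorem hasLargeSubspace_of_form_le (S U : Finset V) (hUS : U ⊆ S)
    (hN : ∀ u ∈ U, ∀ v, G.Adj u v → v ∈ S)
    (hform : ∀ x : V → ℝ, (∀ v ∉ U, x v = 0) →
      σ * (x ⬝ᵥ ((G.adjMatrix ℝ).mulVec x)) ≤ x ⬝ᵥ x)
    (hdim : S.card ≤ 2 * U.card) (hstrict : (∃ v, v ∉ S) ∨ S.card < 2 * U.card)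
    (ih : (∃ v, v ∉ S) → (G.induce {v | v ∉ S}).HasLargeSubspace σ) :
    G.HasLargeSubspace σ := by
  have hfin := finrank_range_extendByZero U
  refine hasLargeSubspace_of_induce S (LinearMap.range
    (Function.ExtendByZero.linearMap ℝ (Subtype.val : U → V))) ?_ ?_ ?_ (hfin ▸ hdim)
    (hfin ▸ hstrict) ih
  · exact fun x hx v hv => eq_zero_of_mem_range_extendByZero hx fun h => hv (hUS h)
  · intro x hx v hv
    refine Finset.sum_eq_zero fun w _ => ?_
    by_cases hw : w ∈ U
    · have : ¬ G.Adj v w := fun h => hv (hN w hw v h.symm)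
      simp [this]
    · rw [eq_zero_of_mem_range_extendByZero hx hw, mul_zero]
  · exact fun x hx => hform x fun v hv => eq_zero_of_mem_range_extendByZero hx hv

open Classical in
theorem hasLargeSubspace_of_vertex (S : Finset V) (v : V) (hv : v ∈ S)
    (hN : ∀ w, G.Adj v w → w ∈ S) (hdim : S.card ≤ 2)
    (hstrict : (∃ v, v ∉ S) ∨ S.card < 2)
    (ih : (∃ v, v ∉ S) → (G.induce {v | v ∉ S}).HasLargeSubspace σ) :
    G.HasLargeSubspace σ := by
  refine hasLargeSubspace_of_form_le S {v} (by simpa using hv) (by simpa using hN) ?_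
    (by simpa using hdim) (by simpa using hstrict) ih
  intro x hx
  have hx' : ∀ w, w ≠ v → x w = 0 := fun w hw => hx w (by simpa using hw)
  have hd : ∀ z : V → ℝ, x ⬝ᵥ z = x v * z v := fun z =>
    Fintype.sum_eq_single v fun w hw => by rw [hx' w hw, zero_mul]
  rw [hd, hd, Matrix.mulVec, dotProduct_comm, hd]
  simp only [adjMatrix_apply, SimpleGraph.irrefl, if_false, mul_zero]
  nlinarith [sq_nonneg (x v)]

open Classical in
theorem dotProduct_adjMatrix_of_pair {u v : V} (huv : u ≠ v) {x : V → ℝ}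
    (hx : ∀ w, w ≠ u ∧ w ≠ v → x w = 0) :
    x ⬝ᵥ ((G.adjMatrix ℝ).mulVec x) = 2 * (if G.Adj u v then 1 else 0) * (x u * x v) ∧
      x ⬝ᵥ x = x u ^ 2 + x v ^ 2 := by
  have hd : ∀ z : V → ℝ, x ⬝ᵥ z = x u * z u + x v * z v := fun z =>
    Fintype.sum_eq_add u v huv fun w hw => by rw [hx w hw, zero_mul]
  have hm : ∀ w, (G.adjMatrix ℝ).mulVec x w =
      x u * G.adjMatrix ℝ w u + x v * G.adjMatrix ℝ w v := fun w => by
    rw [Matrix.mulVec, dotProduct_comm, hd]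
  rw [hd, hd, hm, hm]
  simp only [adjMatrix_apply, SimpleGraph.irrefl, if_false, G.adj_comm v u]
  constructor <;> ring

open Classical in
theorem hasLargeSubspace_of_edge (hσ : |σ| = 1) (S : Finset V) {u v : V} (huv : G.Adj u v)
    (hu : u ∈ S) (hv : v ∈ S) (hNu : ∀ w, G.Adj u w → w ∈ S) (hNv : ∀ w, G.Adj v w → w ∈ S)
    (hdim : S.card ≤ 4) (hstrict : (∃ v, v ∉ S) ∨ S.card < 4)
    (ih : (∃ v, v ∉ S) → (G.induce {v | v ∉ S}).HasLargeSubspace σ) :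
    G.HasLargeSubspace σ := by
  have hc : ({u, v} : Finset V).card = 2 := Finset.card_pair huv.ne
  refine hasLargeSubspace_of_form_le S {u, v} (by simp [Finset.insert_subset_iff, hu, hv]) ?_ ?_
    (by rw [hc]; exact hdim) (by rw [hc]; exact hstrict) ih
  · simp only [Finset.mem_insert, Finset.mem_singleton]
    rintro w (rfl | rfl)
    exacts [hNu, hNv]
  · intro x hx
    obtain ⟨h1, h2⟩ := dotProduct_adjMatrix_of_pair (G := G) huv.ne (x := x)
      (fun w hw => hx w (by simpa using hw))
    rw [h1, h2, if_pos huv]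
    rcases (abs_eq zero_le_one).1 hσ with rfl | rfl
    · nlinarith [sq_nonneg (x u - x v)]
    · nlinarith [sq_nonneg (x u + x v)]

open Classical in
theorem hasLargeSubspace_of_twins (hσ : |σ| = 1) (S : Finset V) {u v : V} (huv : u ≠ v)
    (hS : ∀ w, w ∈ S ↔ w = u ∨ w = v)
    (htwin : ∀ w, w ≠ u → w ≠ v → (G.Adj u w ↔ G.Adj v w)) (hne : ∃ w, w ∉ S)
    (ih : (∃ v, v ∉ S) → (G.induce {v | v ∉ S}).HasLargeSubspace σ) :
    G.HasLargeSubspace σ := by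
  set y : V → ℝ := Pi.single u 1 - Pi.single v 1 with hy
  have hyu : y u = 1 := by simp [hy, huv]
  have hyv : y v = -1 := by simp [hy, huv.symm]
  have hyw : ∀ w, w ≠ u ∧ w ≠ v → y w = 0 := fun w hw => by simp [hy, hw.1, hw.2]
  have hy0 : y ≠ 0 := fun h => by simp [h] at hyu
  have hSc : S.card = 2 := by
    rw [show S = {u, v} by ext w; simp [hS]]
    exact Finset.card_pair huv
  have hmem : ∀ x ∈ Submodule.span ℝ {y}, ∃ a : ℝ, x = a • y := fun x hx => by
    obtain ⟨a, rfl⟩ := Submodule.mem_span_singleton.1 hx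
    exact ⟨a, rfl⟩
  have hfin := finrank_span_singleton (K := ℝ) hy0
  refine hasLargeSubspace_of_induce S (Submodule.span ℝ {y}) ?_ ?_ ?_ (by rw [hSc, hfin])
    (Or.inl hne) ih
  · intro x hx w hw
    obtain ⟨a, rfl⟩ := hmem x hx
    rw [hS, not_or] at hw
    simp [hyw w hw]
  · intro x hx w hw
    obtain ⟨a, rfl⟩ := hmem x hx
    rw [hS, not_or] at hw
    have h1 : (G.adjMatrix ℝ).mulVec y w = G.adjMatrix ℝ w u - G.adjMatrix ℝ w v := by
      rw [Matrix.mulVec, dotProduct, Fintype.sum_eq_add u v huv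
        fun t ht => by rw [hyw t ht, mul_zero], hyu, hyv]
      ring
    rw [Matrix.mulVec_smul, Pi.smul_apply, h1]
    simp only [adjMatrix_apply, G.adj_comm w, htwin w hw.1 hw.2, sub_self, smul_zero]
  · intro x hx
    obtain ⟨a, rfl⟩ := hmem x hx
    obtain ⟨h1, h2⟩ := dotProduct_adjMatrix_of_pair (G := G) huv (x := a • y)
      (fun w hw => by simp [hyw w hw])
    rw [h1, h2]
    simp only [Pi.smul_apply, smul_eq_mul, hyu, hyv]
    rcases (abs_eq zero_le_one).1 hσ with rfl | rfl <;> split_ifs <;> nlinarith [sq_nonneg a]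

end SimpleGraph
namespace SimpleGraph

theorem hasMinor_completeGraph_four {V : Type*} {G : SimpleGraph V} {A B C D : Set V}
    (hA : (G.induce A).Connected) (hB : (G.induce B).Connected) (hC : (G.induce C).Connected)
    (hD : (G.induce D).Connected) (hAB : Disjoint A B) (hAC : Disjoint A C) (hAD : Disjoint A D)
    (hBC : Disjoint B C) (hBD : Disjoint B D) (hCD : Disjoint C D)
    (eAB : ∃ x ∈ A, ∃ y ∈ B, G.Adj x y) (eAC : ∃ x ∈ A, ∃ y ∈ C, G.Adj x y)
    (eAD : ∃ x ∈ A, ∃ y ∈ D, G.Adj x y) (eBC : ∃ x ∈ B, ∃ y ∈ C, G.Adj x y)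
    (eBD : ∃ x ∈ B, ∃ y ∈ D, G.Adj x y) (eCD : ∃ x ∈ C, ∃ y ∈ D, G.Adj x y) :
    G.HasMinor (⊤ : SimpleGraph (Fin 4)) := by
  have flip : ∀ {S T : Set V}, (∃ x ∈ S, ∃ y ∈ T, G.Adj x y) → ∃ x ∈ T, ∃ y ∈ S, G.Adj x y :=
    fun ⟨x, hx, y, hy, h⟩ => ⟨y, hy, x, hx, h.symm⟩
  refine ⟨![A, B, C, D], ?_, ?_, ?_⟩
  · intro w
    fin_cases w <;> assumption
  · intro w w' h
    fin_cases w <;> fin_cases w' <;>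
      first
      | exact absurd rfl h
      | assumption
      | (refine Disjoint.symm ?_; assumption)
  · intro w w' h
    fin_cases w <;> fin_cases w' <;>
      first
      | exact absurd rfl h.ne
      | assumption
      | (refine flip ?_; assumption)

theorem induce_singleton_connected {V : Type*} (G : SimpleGraph V) (v : V) :
    (G.induce {v}).Connected := by
  have : Nonempty ({v} : Set V) := ⟨⟨v, rfl⟩⟩
  have : Subsingleton ({v} : Set V) := (Set.subsingleton_coe _).2 Set.subsingleton_singleton
  exact ⟨Preconnected.of_subsingleton⟩

theorem induce_insert_connected {V : Type*} {G : SimpleGraph V} {R : Set V} {a r : V}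
    (hR : (G.induce R).Connected) (hr : r ∈ R) (h : G.Adj r a) :
    (G.induce (insert a R)).Connected := by
  have heq : insert a R = R ∪ {r, a} := by
    ext x
    simp only [Set.mem_insert_iff, Set.mem_union, Set.mem_singleton_iff]
    constructor
    · rintro (h | h) <;> simp [h]
    · rintro (h | rfl | h)
      exacts [Or.inr h, Or.inr hr, Or.inl h]
  rw [heq]
  exact induce_union_connected hR.preconnected (induce_pair_connected_of_adj h).preconnected
    ⟨r, hr, by simp⟩

open Classical in
/-- Two vertices of a connected part, both adjacent to each of two adjacent connected roots. -/
theorem hasMinor_of_two_common_neighbors {V : Type*} {G : SimpleGraph V} {R C : Set V} {a r : V}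
    (hR : (G.induce R).Connected) (haR : a ∉ R) (hr : r ∈ R) (hra : G.Adj r a) (haC : a ∉ C)
    (hRC : Disjoint R C) (c₁ c₂ : C) (hne : c₁ ≠ c₂) (hreach : (G.induce C).Reachable c₁ c₂)
    (h₁ : G.Adj c₁ a) (h₂ : G.Adj c₂ a) (h₁R : ∃ r ∈ R, G.Adj c₁ r) (h₂R : ∃ r ∈ R, G.Adj c₂ r) :
    G.HasMinor (⊤ : SimpleGraph (Fin 4)) := by
  obtain ⟨p, hp⟩ := hreach.exists_isPath
  cases p with
  | nil => exact absurd rfl hne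
  | @cons _ d _ hd q =>
    have hq := (Walk.cons_isPath_iff hd q).1 hp
    let q' := q.map (Embedding.induce C).toHom
    have hq' : ∀ x, x ∈ q'.support ↔ ∃ h : x ∈ C, (⟨x, h⟩ : C) ∈ q.support := by
      intro x
      rw [Walk.support_map, List.mem_map]
      constructor
      · rintro ⟨y, hy, rfl⟩
        exact ⟨y.2, hy⟩
      · rintro ⟨h, hx⟩
        exact ⟨⟨x, h⟩, hx, rfl⟩
    have hc₂ : c₂.1 ∈ q'.support := (hq' _).2 ⟨c₂.2, q.end_mem_support⟩
    have hsub : {x | x ∈ q'.support} ⊆ C := fun x hx => ((hq' x).1 hx).1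
    obtain ⟨r₁, hr₁, h₁R⟩ := h₁R
    obtain ⟨r₂, hr₂, h₂R⟩ := h₂R
    refine hasMinor_completeGraph_four hR (G.induce_singleton_connected a)
      (G.induce_singleton_connected c₁.1) q'.connected_induce_support
      (Set.disjoint_singleton_right.2 haR)
      (Set.disjoint_singleton_right.2 fun h => Set.disjoint_left.1 hRC h c₁.2)
      (hRC.mono_right hsub)
      (Set.disjoint_singleton.2 fun h => haC (h ▸ c₁.2))
      (Set.disjoint_singleton_left.2 fun h => haC (hsub h))
      (Set.disjoint_singleton_left.2 fun h => hq.2 ?_)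
      ⟨r, hr, a, rfl, hra⟩ ⟨r₁, hr₁, c₁, rfl, h₁R.symm⟩ ⟨r₂, hr₂, c₂, hc₂, h₂R.symm⟩
      ⟨a, rfl, c₁, rfl, h₁.symm⟩ ⟨a, rfl, c₂, hc₂, h₂.symm⟩
      ⟨c₁, rfl, d, (hq' _).2 ⟨d.2, q.start_mem_support⟩, hd⟩
    obtain ⟨h', h''⟩ := (hq' _).1 h
    exact h''

open Classical in
theorem exists_root_edge {V : Type*} {G : SimpleGraph V} {C : Finset V} (hC : C.Nonempty)
    (hdeg : ∀ c ∈ C, 3 ≤ (C.filter (G.Adj c)).card) :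
    ∃ (c₀ c₁ : V) (C' : Finset V), G.Adj c₀ c₁ ∧ c₀ ∉ C' ∧ c₁ ∉ C' ∧ C'.card + 2 = C.card ∧
      C'.Nonempty ∧ ∀ c ∈ C', 3 ≤ (C'.filter (G.Adj c)).card + (if G.Adj c c₁ then 1 else 0) +
        (if G.Adj c c₀ then 1 else 0) := by
  obtain ⟨c₀, hc₀⟩ := hC
  obtain ⟨c₁, hc₁⟩ : (C.filter (G.Adj c₀)).Nonempty :=
    Finset.card_pos.1 (by have := hdeg c₀ hc₀; omega)
  obtain ⟨hc₁C, h01⟩ := Finset.mem_filter.1 hc₁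
  have hc₁' : c₁ ∈ C.erase c₀ := Finset.mem_erase.2 ⟨h01.ne', hc₁C⟩
  have hcard : ((C.erase c₀).erase c₁).card + 2 = C.card := by
    rw [Finset.card_erase_of_mem hc₁', Finset.card_erase_of_mem hc₀]
    have := Finset.card_pos.2 ⟨c₁, hc₁'⟩
    rw [Finset.card_erase_of_mem hc₀] at this
    omega
  refine ⟨c₀, c₁, (C.erase c₀).erase c₁, h01, by simp, by simp, hcard, ?_, ?_⟩
  · refine Finset.card_pos.1 ?_
    have h1 := hdeg c₀ hc₀
    have h2 := Finset.card_le_card (Finset.filter_subset (G.Adj c₀) C)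
    omega
  · intro c hc
    have hcC := Finset.mem_of_mem_erase (Finset.mem_of_mem_erase hc)
    have h0 := hdeg c hcC
    have h1 : (C.filter (G.Adj c)).card = (((C.erase c₀).erase c₁).filter (G.Adj c)).card +
        (if G.Adj c c₁ then 1 else 0) + if G.Adj c c₀ then 1 else 0 := by
      conv_lhs => rw [← Finset.insert_erase hc₀, ← Finset.insert_erase hc₁',
        Finset.filter_insert, Finset.filter_insert]
      have := h01.ne
      split_ifs <;> simp [this, Finset.card_insert_of_notMem]
    rwa [h1] at h0

open Classical in
/-- A rooted form of Dirac's theorem: the connected set `R` and its neighbour `a` are the ends of a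
root edge, and every vertex of `C` has at least three neighbours once `R` is contracted. -/
theorem hasMinor_of_rooted {V : Type*} (G : SimpleGraph V) (n : ℕ) :
    ∀ (R : Set V) (a r : V) (C : Finset V), C.card ≤ n → (G.induce R).Connected → a ∉ R → r ∈ R →
      G.Adj r a → a ∉ C → Disjoint R C → C.Nonempty →
      (∀ c ∈ C, 3 ≤ (C.filter (G.Adj c)).card + (if G.Adj c a then 1 else 0) +
        (if ∃ r ∈ R, G.Adj c r then 1 else 0)) →
      G.HasMinor (⊤ : SimpleGraph (Fin 4)) := by
  induction n with
  | zero =>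
    intro R a r C hn _ _ _ _ _ _ hC
    exact absurd (Finset.card_pos.2 hC) (by omega)
  | succ n ih =>
    intro R a r C hn hR haR hr hra haC hRC hC hdeg
    by_cases hconn : ∀ c₁ c₂ : (C : Set V), (G.induce (C : Set V)).Reachable c₁ c₂
    swap
    · push Not at hconn
      obtain ⟨c₁, c₂, hc⟩ := hconn
      set C' := C.filter fun c => ∃ h : c ∈ (C : Set V),
        (G.induce (C : Set V)).Reachable c₁ ⟨c, h⟩ with hC'
      have hlt : C'.card < C.card := Finset.card_lt_card
        ⟨Finset.filter_subset _ _, fun h => by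
          obtain ⟨-, _, h'⟩ := Finset.mem_filter.1 (h (Finset.mem_coe.1 c₂.2))
          exact hc h'⟩
      refine ih R a r C' (by omega) hR haR hr hra (fun h => haC (Finset.mem_filter.1 h).1)
        (hRC.mono_right (Finset.coe_subset.2 (Finset.filter_subset _ C)))
        ⟨c₁, Finset.mem_filter.2 ⟨c₁.2, c₁.2, Reachable.refl _⟩⟩ ?_
      intro c hc
      obtain ⟨hcC, hcC', hreach⟩ := Finset.mem_filter.1 hc
      refine (hdeg c hcC).trans ?_
      have hsub : C.filter (G.Adj c) ⊆ C'.filter (G.Adj c) := by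
        intro d hd
        obtain ⟨hdC, hcd⟩ := Finset.mem_filter.1 hd
        refine Finset.mem_filter.2 ⟨Finset.mem_filter.2 ⟨hdC, hdC, hreach.trans ?_⟩, hcd⟩
        exact Adj.reachable (G := G.induce (C : Set V)) hcd
      have := Finset.card_le_card hsub
      omega
    by_cases htwo : ∃ c₁ ∈ C, ∃ c₂ ∈ C, c₁ ≠ c₂ ∧ G.Adj c₁ a ∧ G.Adj c₂ a ∧
        (∃ r ∈ R, G.Adj c₁ r) ∧ ∃ r ∈ R, G.Adj c₂ r
    · obtain ⟨c₁, hc₁, c₂, hc₂, hne, h₁, h₂, h₁R, h₂R⟩ := htwo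
      exact hasMinor_of_two_common_neighbors hR haR hr hra haC hRC ⟨c₁, hc₁⟩ ⟨c₂, hc₂⟩
        (by simpa using hne) (hconn _ _) h₁ h₂ h₁R h₂R
    by_cases hadj : ∃ b ∈ C, (G.Adj b a ∨ ∃ r ∈ R, G.Adj b r)
    · have hb : ∃ b ∈ C, (∃ r ∈ insert a R, G.Adj r b) ∧
          ∀ c ∈ C, c ≠ b → ¬ (G.Adj c a ∧ ∃ r ∈ R, G.Adj c r) := by
        by_cases hboth : ∃ b ∈ C, G.Adj b a ∧ ∃ r ∈ R, G.Adj b r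
        · obtain ⟨b, hb, hba, hbR⟩ := hboth
          exact ⟨b, hb, ⟨a, Set.mem_insert _ _, hba.symm⟩, fun c hc hne h =>
            htwo ⟨c, hc, b, hb, hne, h.1, hba, h.2, hbR⟩⟩
        · push Not at hboth
          obtain ⟨b, hb, hb'⟩ := hadj
          refine ⟨b, hb, ?_, fun c hc _ h => ?_⟩
          · rcases hb' with h | ⟨s, hs, h⟩
            · exact ⟨a, Set.mem_insert _ _, h.symm⟩
            · exact ⟨s, Set.mem_insert_of_mem _ hs, h.symm⟩
          · obtain ⟨s, hs, h'⟩ := h.2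
            exact hboth c hc h.1 s hs h'
      obtain ⟨b, hbC, ⟨s, hs, hsb⟩, hnot⟩ := hb
      refine ih (insert a R) b s (C.erase b) ?_ (induce_insert_connected hR hr hra) ?_ hs hsb
        (Finset.notMem_erase b C) ?_ ?_ ?_
      · rw [Finset.card_erase_of_mem hbC]
        omega
      · rintro (rfl | h)
        · exact haC hbC
        · exact Set.disjoint_left.1 hRC h hbC
      · rw [Set.disjoint_left]
        rintro x (rfl | hx) hx'
        · exact haC (Finset.mem_of_mem_erase hx')
        · exact Set.disjoint_left.1 hRC hx (Finset.mem_of_mem_erase hx')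
      · by_contra hempty
        have h1 : C.filter (G.Adj b) = ∅ := by
          refine Finset.filter_eq_empty_iff.2 fun c hc h => hempty ⟨c, ?_⟩
          exact Finset.mem_erase.2 ⟨h.ne', hc⟩
        have := hdeg b hbC
        rw [h1, Finset.card_empty] at this
        split_ifs at this <;> omega
      · intro c hc
        obtain ⟨hcb, hcC⟩ := Finset.mem_erase.1 hc
        have h0 := hdeg c hcC
        have h1 : (C.filter (G.Adj c)).card =
            ((C.erase b).filter (G.Adj c)).card + if G.Adj c b then 1 else 0 := by
          conv_lhs => rw [← Finset.insert_erase hbC, Finset.filter_insert]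
          split_ifs
          · rw [Finset.card_insert_of_notMem (by simp)]
          · rfl
        have h2 : (if G.Adj c a then 1 else 0) + (if ∃ r ∈ R, G.Adj c r then 1 else 0) ≤
            if ∃ r ∈ insert a R, G.Adj c r then 1 else 0 := by
          have h3 := hnot c hcC hcb
          have h4 : (∃ r ∈ insert a R, G.Adj c r) ↔ (G.Adj c a ∨ ∃ r ∈ R, G.Adj c r) := by
            simp
          simp only [h4]
          by_cases h5 : G.Adj c a <;> by_cases h6 : ∃ r ∈ R, G.Adj c r <;> simp_all
        omega
    · push Not at hadj
      have hdeg' : ∀ c ∈ C, 3 ≤ (C.filter (G.Adj c)).card := by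
        intro c hc
        have h0 := hdeg c hc
        rw [if_neg (hadj c hc).1, if_neg (by push Not; exact (hadj c hc).2)] at h0
        exact h0
      obtain ⟨c₀, c₁, C', h01, h0, h1, hcard, hC', hdeg''⟩ := exists_root_edge hC hdeg'
      exact ih {c₀} c₁ c₀ C' (by omega) (G.induce_singleton_connected c₀)
        (by simpa using h01.ne') rfl h01 h1 (by simpa using h0) hC' (by simpa using hdeg'')

open Classical in
/-- **Dirac's theorem**: a finite graph of minimum degree at least `3` has a `K₄` minor. -/
theorem hasMinor_of_three_le_degree {V : Type*} [Fintype V] [Nonempty V] (G : SimpleGraph V)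
    (hdeg : ∀ v, 3 ≤ (Finset.univ.filter (G.Adj v)).card) :
    G.HasMinor (⊤ : SimpleGraph (Fin 4)) := by
  obtain ⟨c₀, c₁, C, h01, h0, h1, -, hC, hdeg'⟩ :=
    exists_root_edge Finset.univ_nonempty fun v _ => hdeg v
  exact hasMinor_of_rooted G _ {c₀} c₁ c₀ C le_rfl (G.induce_singleton_connected c₀)
    (by simpa using h01.ne') rfl h01 h1 (by simpa using h0) hC (by simpa using hdeg')

end SimpleGraph
namespace SimpleGraph

theorem induce_preimage_connected {V W : Type*} {G : SimpleGraph V} {H : SimpleGraph W} (g : V → W)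
    (hfib : ∀ w, (G.induce (g ⁻¹' {w})).Connected)
    (hadj : ∀ w w', H.Adj w w' → ∃ x y, g x = w ∧ g y = w' ∧ G.Adj x y) {S : Set W}
    (hS : (H.induce S).Connected) : (G.induce (g ⁻¹' S)).Connected := by
  have hsub : ∀ (x y : g ⁻¹' S), g x = g y → (G.induce (g ⁻¹' S)).Reachable x y := by
    intro x y hxy
    have hle : g ⁻¹' {g y} ⊆ g ⁻¹' S := by
      intro z hz
      have h1 : g z = g y := hz
      have h2 : g y ∈ S := y.2
      rwa [Set.mem_preimage, h1]
    exact ((hfib (g y)).preconnected ⟨x, hxy⟩ ⟨y, rfl⟩).map (induceHomOfLE G hle).toHom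
  have hwalk : ∀ {s t : S}, (H.induce S).Walk s t → ∀ x y : g ⁻¹' S, g x = s → g y = t →
      (G.induce (g ⁻¹' S)).Reachable x y := by
    intro s t p
    induction p with
    | nil => exact fun x y hx hy => hsub x y (hx.trans hy.symm)
    | @cons s s' t h p ih =>
      intro x y hx hy
      obtain ⟨x', y', hx', hy', hxy⟩ := hadj _ _ h
      have hx'S : x' ∈ g ⁻¹' S := by rw [Set.mem_preimage, hx']; exact s.2
      have hy'S : y' ∈ g ⁻¹' S := by rw [Set.mem_preimage, hy']; exact s'.2
      have hstep : (G.induce (g ⁻¹' S)).Adj ⟨x', hx'S⟩ ⟨y', hy'S⟩ := hxy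
      exact ((hsub x ⟨x', hx'S⟩ (hx.trans hx'.symm)).trans hstep.reachable).trans
        (ih ⟨y', hy'S⟩ y hy' hy)
  refine (connected_iff _).2 ⟨fun x y => ?_, ?_⟩
  · obtain ⟨p⟩ := hS.preconnected ⟨g x, x.2⟩ ⟨g y, y.2⟩
    exact hwalk p x y rfl rfl
  · obtain ⟨w⟩ := hS.nonempty
    obtain ⟨v⟩ := (hfib w).nonempty
    have hv : g v = w := v.2
    exact ⟨⟨v, by rw [Set.mem_preimage, hv]; exact w.2⟩⟩

theorem HasMinor.of_contraction {V W U : Type*} {G : SimpleGraph V} {H : SimpleGraph W}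
    {K : SimpleGraph U} (g : V → W) (hfib : ∀ w, (G.induce (g ⁻¹' {w})).Connected)
    (hadj : ∀ w w', H.Adj w w' → ∃ x y, g x = w ∧ g y = w' ∧ G.Adj x y) (h : H.HasMinor K) :
    G.HasMinor K := by
  obtain ⟨B, hB, hdisj, hB'⟩ := h
  refine ⟨fun u => g ⁻¹' B u, fun u => induce_preimage_connected g hfib hadj (hB u),
    fun u u' huv => (hdisj u u' huv).preimage g, fun u u' huv => ?_⟩
  obtain ⟨x, hx, y, hy, hxy⟩ := hB' u u' huv
  obtain ⟨x', y', rfl, rfl, h⟩ := hadj x y hxy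
  exact ⟨x', hx, y', hy, h⟩

theorem HasMinor.of_induce {V U : Type*} {G : SimpleGraph V} {K : SimpleGraph U} {S : Set V}
    (h : (G.induce S).HasMinor K) : G.HasMinor K := by
  obtain ⟨B, hB, hdisj, hB'⟩ := h
  refine ⟨fun u => Subtype.val '' B u, fun u => ?_, fun u u' huv =>
    (Set.disjoint_image_iff Subtype.val_injective).2 (hdisj u u' huv), fun u u' huv => ?_⟩
  · let f : (G.induce S).induce (B u) →g G.induce (Subtype.val '' B u) :=
      { toFun := fun x => ⟨x.1.1, x.1, x.2, rfl⟩
        map_rel' := fun h => h }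
    refine (hB u).map f ?_
    rintro ⟨_, x, hx, rfl⟩
    exact ⟨⟨x, hx⟩, rfl⟩
  · obtain ⟨x, hx, y, hy, hxy⟩ := hB' u u' huv
    exact ⟨x, ⟨x, hx, rfl⟩, y, ⟨y, hy, rfl⟩, hxy⟩

theorem induce_star_connected {V : Type*} {G : SimpleGraph V} {S : Set V} {c : V} (hc : c ∈ S)
    (h : ∀ v ∈ S, v ≠ c → G.Adj v c) : (G.induce S).Connected := by
  refine induce_connected_of_patches c hc fun {v} hv => ?_
  by_cases hvc : v = c
  · subst hvc
    exact ⟨S, le_rfl, hv, hv, Reachable.refl _⟩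
  · exact ⟨{c, v}, by simp [Set.insert_subset_iff, hc, hv], by simp, by simp,
      (induce_pair_connected_of_adj (h v hv hvc).symm).preconnected _ _⟩

open Classical in
/-- Suppressing the vertices of degree `2`: a graph with all degrees `2` or `3` in which no two
vertices are twins and every edge has at least three further neighbours has a `K₄` minor. -/
theorem hasMinor_of_no_reducible {V : Type*} [Fintype V] [Nonempty V] (G : SimpleGraph V)
    (hdeg : ∀ v, (Finset.univ.filter (G.Adj v)).card = 2 ∨ (Finset.univ.filter (G.Adj v)).card = 3)
    (htwin : ∀ u v, u ≠ v → ¬ ∀ w, w ≠ u → w ≠ v → (G.Adj u w ↔ G.Adj v w))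
    (hedge : ∀ u v, G.Adj u v →
      4 < (Finset.univ.filter (G.Adj u) ∪ Finset.univ.filter (G.Adj v)).card) :
    G.HasMinor (⊤ : SimpleGraph (Fin 4)) := by
  obtain ⟨N, hN⟩ : ∃ N : V → Finset V, ∀ v, Finset.univ.filter (G.Adj v) = N v :=
    ⟨_, fun _ => rfl⟩
  simp only [hN] at hdeg hedge
  have hmem : ∀ u v, v ∈ N u ↔ G.Adj u v := fun u v => by simp [← hN]
  have htwo : ∀ z, (N z).card = 2 → ∀ v, G.Adj z v → (N v).card = 3 ∧ Disjoint (N z) (N v) := by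
    intro z hz v hzv
    have h1 := hedge z v hzv
    have h2 := Finset.card_union_add_card_inter (N z) (N v)
    have h3 := hdeg v
    refine ⟨by omega, Finset.disjoint_iff_inter_eq_empty.2 (Finset.card_eq_zero.1 ?_)⟩
    omega
  have hpair : ∀ z, (N z).card = 2 → ∀ x y, x ≠ y → G.Adj z x → G.Adj z y → N z = {x, y} := by
    intro z hz x y hxy hx hy
    refine (Finset.eq_of_subset_of_card_le ?_ ?_).symm
    · simp [Finset.insert_subset_iff, hmem, hx, hy]
    · rw [hz, Finset.card_pair hxy]
  let W := {v // (N v).card = 3}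
  have hproj : ∀ v : V, ∃ w : W, v = w ∨ ((N v).card = 2 ∧ G.Adj v w) := by
    intro v
    rcases hdeg v with h | h
    · obtain ⟨w, hw⟩ : (N v).Nonempty := Finset.card_pos.1 (by omega)
      rw [hmem] at hw
      exact ⟨⟨w, (htwo v h w hw).1⟩, Or.inr ⟨h, hw⟩⟩
    · exact ⟨⟨v, h⟩, Or.inl rfl⟩
  choose g hg using hproj
  have hgW : ∀ w : W, g w = w := by
    intro w
    rcases hg w with h | h
    · exact Subtype.ext h.symm
    · have := w.2
      omega
  let H : SimpleGraph W :=
    { Adj := fun x y => x ≠ y ∧ (G.Adj x y ∨ ∃ z, (N z).card = 2 ∧ G.Adj z x ∧ G.Adj z y)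
      symm := ⟨fun x y h => ⟨h.1.symm, h.2.elim (fun h => Or.inl h.symm)
        fun ⟨z, hz, hx, hy⟩ => Or.inr ⟨z, hz, hy, hx⟩⟩⟩
      loopless := ⟨fun x h => h.1 rfl⟩ }
  have hHdeg : ∀ x : W, 3 ≤ (Finset.univ.filter (H.Adj x)).card := by
    intro x
    have hother : ∀ y, ∃ t : W, G.Adj x y → t ≠ x ∧ (y = t ∨ ((N y).card = 2 ∧ G.Adj y t)) := by
      intro y
      by_cases hxy : G.Adj x y
      · rcases hdeg y with h | h
        · obtain ⟨t, ht, htx⟩ := Finset.exists_mem_ne (s := N y) (by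
            have : (N y).card = 2 := h
            omega) x
          rw [hmem] at ht
          exact ⟨⟨t, (htwo y h t ht).1⟩, fun _ =>
            ⟨fun h => htx (congrArg Subtype.val h), Or.inr ⟨h, ht⟩⟩⟩
        · exact ⟨⟨y, h⟩, fun _ => ⟨fun h => hxy.ne (congrArg Subtype.val h).symm, Or.inl rfl⟩⟩
      · exact ⟨x, fun h => absurd h hxy⟩
    choose f hf using hother
    have hmixed : ∀ y₂, G.Adj x y₂ → (N y₂).card = 2 → ∀ t, G.Adj x t → ¬ G.Adj y₂ t :=
      fun y₂ h₂ hc t ht h =>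
        Finset.disjoint_left.1 (htwo y₂ hc x h₂.symm).2 ((hmem _ _).2 h) ((hmem _ _).2 ht)
    refine (show 3 ≤ (N x).card from x.2.ge).trans (Finset.card_le_card_of_injOn f ?_ ?_)
    · intro y hy
      have hxy := (hmem _ _).1 hy
      obtain ⟨hne, h⟩ := hf y hxy
      simp only [Finset.coe_filter, Finset.mem_univ, true_and, Set.mem_ofPred_eq]
      refine ⟨hne.symm, ?_⟩
      rcases h with h | ⟨hc, h⟩
      · exact Or.inl (h ▸ hxy)
      · exact Or.inr ⟨y, hc, hxy.symm, h⟩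
    · intro y₁ hy₁ y₂ hy₂ heq
      have h₁ := (hmem _ _).1 hy₁
      have h₂ := (hmem _ _).1 hy₂
      obtain ⟨hne₁, hf₁⟩ := hf y₁ h₁
      obtain ⟨hne₂, hf₂⟩ := hf y₂ h₂
      rw [heq] at hf₁ hne₁
      rcases hf₁ with e₁ | ⟨hc₁, e₁⟩ <;> rcases hf₂ with e₂ | ⟨hc₂, e₂⟩
      · exact e₁.trans e₂.symm
      · exact absurd e₂ (hmixed y₂ h₂ hc₂ _ (e₁ ▸ h₁))
      · exact absurd e₁ (hmixed y₁ h₁ hc₁ _ (e₂ ▸ h₂))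
      · by_contra hne
        have hxt : x.1 ≠ (f y₂).1 := fun h => hne₁ (Subtype.ext h.symm)
        have hN12 : N y₁ = N y₂ := by
          rw [hpair y₁ hc₁ _ _ hxt h₁.symm e₁, hpair y₂ hc₂ _ _ hxt h₂.symm e₂]
        exact htwin y₁ y₂ hne fun w _ _ => by rw [← hmem, ← hmem, hN12]
  have : Nonempty W := (inferInstance : Nonempty V).map g
  refine (hasMinor_of_three_le_degree H fun x => by convert hHdeg x).of_contraction g (fun w => ?_) fun w w' h => ?_
  · refine induce_star_connected (c := w.1) (hgW w) fun v hv hvw => ?_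
    have hv' : g v = w := hv
    rcases hg v with h | h
    · exact absurd (h.trans (congrArg Subtype.val hv')) hvw
    · rw [hv'] at h
      exact h.2
  · obtain ⟨hne, h | ⟨z, hz, hzw, hzw'⟩⟩ := h
    · exact ⟨w, w', hgW w, hgW w', h⟩
    · have hgz : G.Adj z (g z) := by
        rcases hg z with h | h
        · have h1 := (g z).2
          rw [← h] at h1
          omega
        · exact h.2
      rw [← hmem, hpair z hz w w' (fun h => hne (Subtype.ext h)) hzw hzw', Finset.mem_insert,
        Finset.mem_singleton] at hgz
      rcases hgz with h | h
      · exact ⟨z, w', Subtype.ext h, hgW w', hzw'⟩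
      · exact ⟨w, z, hgW w, Subtype.ext h, hzw.symm⟩

end SimpleGraph
namespace SimpleGraph

open Classical in
theorem exists_twins_of_card_eq_four {V : Type*} [Fintype V] (G : SimpleGraph V)
    (hV : Fintype.card V = 4) (hdeg : ∀ v, 2 ≤ (Finset.univ.filter (G.Adj v)).card) :
    ∃ u v, u ≠ v ∧ ∀ w, w ≠ u → w ≠ v → (G.Adj u w ↔ G.Adj v w) := by
  by_cases h : ∃ u v, u ≠ v ∧ ¬ G.Adj u v
  · obtain ⟨u, v, huv, hnadj⟩ := h
    have hfull : ∀ a b, a ≠ b → ¬ G.Adj a b → ∀ w, w ≠ a → w ≠ b → G.Adj a w := by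
      intro a b hab hn w hwa hwb
      by_contra hw
      have hsub : Finset.univ.filter (G.Adj a) ⊆ Finset.univ \ {a, b, w} := by
        intro x hx
        have hx' : G.Adj a x := (Finset.mem_filter.1 hx).2
        simp only [Finset.mem_sdiff, Finset.mem_univ, true_and, Finset.mem_insert,
          Finset.mem_singleton]
        rintro (rfl | rfl | rfl)
        exacts [hx'.ne rfl, hn hx', hw hx']
      have h1 := Finset.card_le_card hsub
      rw [Finset.card_univ_sdiff, hV,
        Finset.card_eq_three.2 ⟨a, b, w, hab, hwa.symm, hwb.symm, rfl⟩] at h1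
      have := hdeg a
      omega
    exact ⟨u, v, huv, fun w hu hv =>
      iff_of_true (hfull u v huv hnadj w hu hv) (hfull v u huv.symm (fun h => hnadj h.symm) w hv hu)⟩
  · push Not at h
    obtain ⟨u, v, huv⟩ := Fintype.exists_pair_of_one_lt_card (α := V) (by omega)
    exact ⟨u, v, huv, fun w hu hv => iff_of_true (h u w hu.symm) (h v w hv.symm)⟩

open Classical in
theorem hasLargeSubspace_of_minorFree {σ : ℝ} (hσ : |σ| = 1) (n : ℕ) :
    ∀ {V : Type*} [Fintype V] [Nonempty V] (G : SimpleGraph V), Fintype.card V = n →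
      (∀ v, (Finset.univ.filter (G.Adj v)).card ≤ 3) →
      G.MinorFree (⊤ : SimpleGraph (Fin 4)) → G.HasLargeSubspace σ := by
  induction n using Nat.strong_induction_on with
  | _ n ih =>
  intro V _ _ G hn hsub hminor
  have hih : ∀ S : Finset V, S.Nonempty → (∃ v, v ∉ S) →
      (G.induce {v | v ∉ S}).HasLargeSubspace σ := by
    rintro S ⟨s, hs⟩ ⟨v, hv⟩
    have : Nonempty {v | v ∉ S} := ⟨⟨v, hv⟩⟩
    refine ih (Fintype.card {v | v ∉ S}) ?_ _ rfl (fun w => ?_) fun h => hminor h.of_induce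
    · rw [← hn]
      exact Fintype.card_subtype_lt (x := s) (by simpa using hs)
    · refine (Finset.card_le_card_of_injOn Subtype.val ?_ Subtype.val_injective.injOn).trans
        (hsub w)
      intro x hx
      simpa using hx
  by_cases hlow : ∃ v, (Finset.univ.filter (G.Adj v)).card ≤ 1
  · obtain ⟨v, hv⟩ := hlow
    set S := insert v (Finset.univ.filter (G.Adj v)) with hS
    have hvS : v ∈ S := Finset.mem_insert_self _ _
    have hcard : S.card ≤ 2 := (Finset.card_insert_le _ _).trans (by omega)
    have hN : ∀ w, G.Adj v w → w ∈ S := fun w hw => by simp [hS, hw]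
    by_cases hout : (∃ v, v ∉ S) ∨ S.card < 2
    · exact hasLargeSubspace_of_vertex S v hvS hN hcard hout (hih S ⟨v, hvS⟩)
    · push Not at hout
      obtain ⟨u, hu, huv⟩ := Finset.exists_mem_ne hout.2 v
      have hvu : G.Adj v u := by
        rw [hS, Finset.mem_insert, Finset.mem_filter] at hu
        exact (hu.resolve_left huv).2
      exact hasLargeSubspace_of_edge hσ S hvu hvS hu (fun w _ => hout.1 w) (fun w _ => hout.1 w)
        (by omega) (Or.inr (by omega)) (hih S ⟨v, hvS⟩)
  push Not at hlow
  by_cases htwin : ∃ u v, u ≠ v ∧ ∀ w, w ≠ u → w ≠ v → (G.Adj u w ↔ G.Adj v w)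
  · obtain ⟨u, v, huv, htw⟩ := htwin
    obtain ⟨w, hw, hwv⟩ := Finset.exists_mem_ne (hlow u) v
    have hwu : w ≠ u := (Finset.mem_filter.1 hw).2.ne'
    exact hasLargeSubspace_of_twins hσ {u, v} huv (by simp) htw ⟨w, by simp [hwu, hwv]⟩
      (hih _ ⟨u, by simp⟩)
  have hedge : ∃ u v, G.Adj u v ∧
      (Finset.univ.filter (G.Adj u) ∪ Finset.univ.filter (G.Adj v)).card ≤ 4 := by
    by_contra! hedge
    refine hminor (hasMinor_of_no_reducible G (fun v => ?_) (fun u v huv h => ?_) hedge)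
    · have := hsub v
      have := hlow v
      omega
    · exact htwin ⟨u, v, huv, h⟩
  obtain ⟨u, v, huv, hcard⟩ := hedge
  set S := Finset.univ.filter (G.Adj u) ∪ Finset.univ.filter (G.Adj v) with hS
  have hu : u ∈ S := by simp [hS, huv.symm]
  refine hasLargeSubspace_of_edge hσ S huv hu (by simp [hS, huv]) (fun w hw => by simp [hS, hw])
    (fun w hw => by simp [hS, hw]) hcard ?_ (hih S ⟨u, hu⟩)
  by_contra! hfull
  refine htwin (exists_twins_of_card_eq_four G ?_ fun v => hlow v)
  have : S = Finset.univ := Finset.eq_univ_of_forall hfull.1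
  rw [← Finset.card_univ, ← this]
  omega

end SimpleGraph

theorem mainTheorem2 {V : Type*} [Fintype V] [DecidableEq V] [Nonempty V]
    (G : SimpleGraph V) [DecidableRel G.Adj]
    (hsub : G.IsSubcubic) (hminor : G.MinorFree (⊤ : SimpleGraph (Fin 4))) :
    G.hlIndex ≤ 1 := by
  refine G.hlIndex_le_one_of_subspaces fun σ hσ => ?_
  obtain ⟨N, hN, hform⟩ := SimpleGraph.hasLargeSubspace_of_minorFree hσ _ G rfl (fun v => by
    have h := (G.degree_le_maxDegree v).trans hsub
    rw [← SimpleGraph.card_neighborFinset_eq_degree, SimpleGraph.neighborFinset_eq_filter] at h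
    refine le_trans (le_of_eq ?_) h
    congr) hminor
  exact ⟨N, hN, fun x hx => by convert hform x hx⟩
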